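/- \textbf{Setting.} A \emph{task} $(\Theta,A,u)$ consists of a finite state space $\Theta$, a finite action space $A$ and payoff vectors $u(a)\in\mathbb{R}^{\Theta}$, $a\in A$. A belief is any probability vector $p$ on $\Theta$, and $a$ is optimal under $p$ if it maximizes $\mathbb{E}_p u(a)$ over $A$. An $m$-dimensional question profile assigns to each $a\in A$ a matrix $X(a)\in\mathbb{R}^{m\times|\Theta|}$. It is \emph{incentivizable} if there is $V:\mathbb{R}^m\times A\times\Theta\to[0,1]$ such that, for every belief $p$, $$\arg\max_{(r,a)}\mathbb{E}_p[V(r,a,\theta)]=\{(\mathbb{E}_pX(a),a): a\text{ is optimal under }p\},$$ and \emph{robustly incentivizable} if there are invertible matrices $\mu(a)\in\mathbb{R}^{m\times m}$, $a\in A$, such that for every $t\in\mathbb{R}^{m\times|\Theta|}$ the profile $a\mapsto X(a)+\mu(a)t$ is incentivizable. Two distinct actions are \emph{adjacent} if under some belief both are optimal and no other action is; this defines the adjacency graph of the task. Put $\Delta_a^b=\bar u(b)-\bar u(a)$, where $\bar v=v-\frac1{|\Theta|}\sum_{\theta}v(\theta)\mathbf 1$. A graph is \emph{one-block} if it is connected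 and has no cut-vertex. A \emph{minimum cycle basis} (MCB) of a graph is a set of cycles whose (signed) edge incidence vectors form a basis of the real kernel of the vertex-edge incidence matrix and whose total length is minimal among such sets. \textbf{Product task.} Let $I$ be a finite set and for each $i\in I$ let $(\Theta_i,A_i,u_i)$ be a task with $|\Theta_i|\ge2$ and adjacency graph $G_i$, in which no action is weakly dominated by another one (if $u_i(a_i)\le u_i(b_i)$ in every state, then $u_i(a_i)=u_i(b_i)$). Let $\Theta=\prod_i\Theta_i$, $A=\prod_iA_i$ and $u(a;\theta)=\sum_iu_i(a_i,\theta_i)$. Suppose that the adjacency graph $G$ of $(\Theta,A,u)$ is the Cartesian product of the graphs $G_i$ and that each $G_i$ is one-block. Let $m\ge0$ and suppose: (Assumption 1) there is an MCB of $G$ all of whose cycles have length less than $|\Theta|-(m-1)$; (Assumption 3) there is an MCB of $G$ such that, for each of its 4-cycles of the form $(a_i,a_j,a_{-ij}),(b_i,a_j,a_{-ij}),(b_i,b_j,a_{-ij}),(a_i,b_j,a_{-ij})$ with $i\ne j$, the set of vectors $\Delta_a^b$ over neighbouring nodes $a,b$ of the 4-cycle has rank $2$; and for each $i$ there is an MCB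 of $G_i$ such that, for each of its cycles $C$, the set of vectors $\Delta_{a_i}^{b_i}$ (formed from $u_i$) over neighbouring nodes $a_i,b_i$ of $C$ has rank $|C|-1$. \textbf{Theorem.} Under these hypotheses, an $m$-dimensional question profile $X$ is robustly incentivizable if and only if it is taskwise jointly aligned with $u$, that is, there are $d\in\mathbb{R}^{m\times|\Theta|}$, column vectors $\lambda_i\in\mathbb{R}^m$ for $i\in I$, and, for each $a\in A$, an invertible $\Gamma(a)\in\mathbb{R}^{m\times m}$ and a column vector $\kappa(a)\in\mathbb{R}^m$ such that $$X(a)=\Gamma(a)\Big(\sum_i\lambda_iu_i(a)+d\Big)+\kappa(a)\mathbf 1\qquad\text{for all }a\in A,$$ where $u_i(a)$ is the row vector $\theta\mapsto u_i(a_i,\theta_i)$. -/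

import Mathlib

namespace BeliefElicitation

/-! ### Cycles, the cycle space and minimum cycle bases of a graph -/

/-- A cycle of `G`, given by a closed walk without repeated vertices. The base point and the
direction of traversal are part of the data; changing them changes the vector `Cycle.flow`
at most by a sign. -/
structure Cycle {V : Type*} (G : SimpleGraph V) where
  base : V
  walk : G.Walk base base
  isCycle : walk.IsCycle

/-- The length of a cycle: its number of edges. -/
def Cycle.length {V : Type*} {G : SimpleGraph V} (C : Cycle G) : ℕ := C.walk.length

open Classical in
/-- The incidence vector of a cycle, as an antisymmetric function on ordered pairs of vertices:
`1` on the arcs traversed by the cycle, `-1` on the reversed arcs, `0` elsewhere. -/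
noncomputable def Cycle.flow {V : Type*} {G : SimpleGraph V} (C : Cycle G) : V → V → ℝ :=
  fun v w =>
    (if ∃ e ∈ C.walk.darts, e.fst = v ∧ e.snd = w then 1 else 0)
      - (if ∃ e ∈ C.walk.darts, e.fst = w ∧ e.snd = v then 1 else 0)

/-- The cycle space of a finite graph, i.e. the kernel of its vertex-edge incidence matrix. A vector
indexed by the edges, with respect to some orientation, is written as an antisymmetric function
supported on the adjacent pairs, so that no orientation has to be fixed; being in the kernel says
that inflow equals outflow at every vertex. -/
def cycleSpace {V : Type*} [Fintype V] (G : SimpleGraph V) : Submodule ℝ (V → V → ℝ) where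
  carrier := {f | (∀ v w, f v w = - f w v) ∧ (∀ v w, ¬ G.Adj v w → f v w = 0) ∧
    ∀ v, ∑ w, f v w = 0}
  zero_mem' := by simp
  add_mem' := by
    rintro f g ⟨hf₁, hf₂, hf₃⟩ ⟨hg₁, hg₂, hg₃⟩
    refine ⟨fun v w => ?_, fun v w h => ?_, fun v => ?_⟩
    · simp only [Pi.add_apply]
      rw [hf₁ v w, hg₁ v w]
      ring
    · simp [hf₂ v w h, hg₂ v w h]
    · simp [Finset.sum_add_distrib, hf₃ v, hg₃ v]
  smul_mem' := by
    rintro c f ⟨hf₁, hf₂, hf₃⟩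
    refine ⟨fun v w => ?_, fun v w h => ?_, fun v => ?_⟩
    · simp only [Pi.smul_apply, smul_eq_mul]
      rw [hf₁ v w]
      ring
    · simp [hf₂ v w h]
    · simp [← Finset.mul_sum, hf₃ v]

/-- A cycle basis: a set of cycles whose incidence vectors form a basis of the cycle space. -/
def IsCycleBasis {V : Type*} [Fintype V] (G : SimpleGraph V) (B : Finset (Cycle G)) : Prop :=
  LinearIndependent ℝ (fun C : B => C.1.flow) ∧
    Submodule.span ℝ (Set.range fun C : B => C.1.flow) = cycleSpace G

/-- A minimum cycle basis (MCB): a cycle basis of least total length. -/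
def IsMinCycleBasis {V : Type*} [Fintype V] (G : SimpleGraph V) (B : Finset (Cycle G)) : Prop :=
  IsCycleBasis G B ∧
    ∀ B' : Finset (Cycle G), IsCycleBasis G B' → ∑ C ∈ B, C.length ≤ ∑ C ∈ B', C.length

/-- A graph is one-block if it is connected and has no cut-vertex, i.e. no vertex whose removal
leaves two vertices that cannot be joined by a path. -/
def IsOneBlock {V : Type*} (G : SimpleGraph V) : Prop :=
  G.Connected ∧ ∀ v : V, (G.induce {w | w ≠ v}).Preconnected

/-- The Cartesian product of a family of graphs. -/
def cartesianProduct {ι : Type*} {A : ι → Type*} (G : ∀ i, SimpleGraph (A i)) :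
    SimpleGraph (∀ i, A i) where
  Adj a b := ∃ i, (G i).Adj (a i) (b i) ∧ ∀ j, j ≠ i → a j = b j
  symm := ⟨fun _ _ ⟨i, h, h'⟩ => ⟨i, h.symm, fun j hj => (h' j hj).symm⟩⟩
  loopless := ⟨fun _ ⟨_, h, _⟩ => h.ne rfl⟩

/-- The 4-cycles of a graph on profiles of the form
`(aᵢ, aⱼ, ·), (bᵢ, aⱼ, ·), (bᵢ, bⱼ, ·), (aᵢ, bⱼ, ·)`, with neighbouring profiles differing alternately
in the coordinates `i` and `j`. -/
def Cycle.IsCrossFourCycle {ι : Type*} [DecidableEq ι] {A : ι → Type*}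
    {G : SimpleGraph (∀ i, A i)} (C : Cycle G) : Prop :=
  ∃ (i j : ι) (a : ∀ i, A i) (x : A i) (y : A j), i ≠ j ∧
    C.walk.support =
      [a, Function.update a i x, Function.update (Function.update a i x) j y,
        Function.update a j y, a]

/-! ### Tasks, incentivizability and adjacency -/

/-- The expectation of `v` under the belief `p`. -/
def expect {Θ : Type*} [Fintype Θ] (p v : Θ → ℝ) : ℝ := ∑ θ, p θ * v θ

/-- The action `a` is optimal in the task with payoffs `u` under the belief `p`. -/
def IsOptimal {A Θ : Type*} [Fintype Θ] (u : A → Θ → ℝ) (p : Θ → ℝ) (a : A) : Prop :=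
  ∀ b, expect p (u b) ≤ expect p (u a)

/-- The question profile `X`, which assigns to each action an `m × Θ` matrix, is incentivizable in
the task with payoffs `u`: some elicitation method `V` with values in `[0, 1]` has, under each
belief, exactly the pairs (true expectation of `X a`, `a`) with `a` optimal as its maximizers. -/
def Incentivizable {A Θ : Type*} [Fintype Θ] {m : ℕ} (u : A → Θ → ℝ)
    (X : A → Matrix (Fin m) Θ ℝ) : Prop :=
  ∃ V : (Fin m → ℝ) → A → Θ → ℝ, (∀ r a θ, V r a θ ∈ Set.Icc (0 : ℝ) 1) ∧
    ∀ p ∈ stdSimplex ℝ Θ,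
      {x : (Fin m → ℝ) × A | ∀ y : (Fin m → ℝ) × A,
          expect p (V y.1 y.2) ≤ expect p (V x.1 x.2)} =
        {x : (Fin m → ℝ) × A | IsOptimal u p x.2 ∧ x.1 = fun k => expect p (X x.2 k)}

/-- Robust incentivizability: there are invertible matrices `μ a` such that all the perturbations
`X a + μ a * t` of `X` are incentivizable. -/
def RobustlyIncentivizable {A Θ : Type*} [Fintype Θ] {m : ℕ} (u : A → Θ → ℝ)
    (X : A → Matrix (Fin m) Θ ℝ) : Prop :=
  ∃ μ : A → Matrix (Fin m) (Fin m) ℝ, (∀ a, IsUnit (μ a)) ∧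
    ∀ t : Matrix (Fin m) Θ ℝ, Incentivizable u (fun a => X a + μ a * t)

/-- The adjacency graph of a task: two (distinct) actions are adjacent if under some belief both are
optimal and no other action is. -/
def adjacencyGraph {A Θ : Type*} [Fintype Θ] (u : A → Θ → ℝ) : SimpleGraph A where
  Adj a b := a ≠ b ∧ ∃ p ∈ stdSimplex ℝ Θ, ∀ c, IsOptimal u p c ↔ (c = a ∨ c = b)
  symm := ⟨fun _ _ ⟨h, p, hp, hc⟩ => ⟨h.symm, p, hp, fun c => (hc c).trans or_comm⟩⟩
  loopless := ⟨fun _ h => h.1 rfl⟩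

/-- No action is weakly dominated by another action. -/
def NoWeakDominance {A Θ : Type*} (u : A → Θ → ℝ) : Prop :=
  ∀ a b : A, (∀ θ, u a θ ≤ u b θ) → u a = u b

/-- The projection `v - (mean of v) 𝟏` of `v` onto the vectors whose coordinates sum to zero. -/
noncomputable def centered {Θ : Type*} [Fintype Θ] (v : Θ → ℝ) : Θ → ℝ :=
  fun θ => v θ - (∑ θ', v θ') / Fintype.card Θ

/-- The payoff difference vector from the action `a` to the action `b`. -/
noncomputable def payoffDiff {A Θ : Type*} [Fintype Θ] (u : A → Θ → ℝ) (a b : A) : Θ → ℝ :=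
  centered (u b) - centered (u a)

/-- The rank of the set of the payoff difference vectors along the arcs of a cycle. -/
noncomputable def Cycle.payoffRank {A Θ : Type*} [Fintype Θ] {G : SimpleGraph A}
    (C : Cycle G) (u : A → Θ → ℝ) : ℕ :=
  Set.finrank ℝ {x : Θ → ℝ | ∃ e ∈ C.walk.darts, x = payoffDiff u e.fst e.snd}

/-! ### Product tasks -/

/-- The payoff `∑ᵢ uᵢ(aᵢ, θᵢ)` of the product of a family of tasks. -/
def productPayoff {ι : Type*} [Fintype ι] {A Θ : ι → Type*} (u : ∀ i, A i → Θ i → ℝ) :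
    (∀ i, A i) → (∀ i, Θ i) → ℝ :=
  fun a θ => ∑ i, u i (a i) (θ i)

/-- Cycle length condition: some MCB of the graph `G` consists of cycles of length less than
`|Θ| - (m - 1)`, where `N` stands for `|Θ|`. -/
def CycleLengthCondition {V : Type*} [Fintype V] (G : SimpleGraph V) (N m : ℕ) : Prop :=
  ∃ B : Finset (Cycle G), IsMinCycleBasis G B ∧
    ∀ C ∈ B, (C.length : ℤ) < (N : ℤ) - ((m : ℤ) - 1)

/-- Rank conditions: the cross-task 4-cycles of an MCB of the product of the task graphs have rank
`2`, and, for each task, the cycles of an MCB of its adjacency graph have rank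
one less than their length. -/
def RankConditions {ι : Type*} [Fintype ι] [DecidableEq ι] {A Θ : ι → Type*}
    [∀ i, Fintype (A i)] [∀ i, Fintype (Θ i)] (u : ∀ i, A i → Θ i → ℝ) : Prop :=
  (∃ B : Finset (Cycle (cartesianProduct fun i => adjacencyGraph (u i))),
      IsMinCycleBasis _ B ∧
        ∀ C ∈ B, C.IsCrossFourCycle → C.payoffRank (productPayoff u) = 2) ∧
    ∀ i, ∃ B : Finset (Cycle (adjacencyGraph (u i))),
      IsMinCycleBasis _ B ∧ ∀ C ∈ B, C.payoffRank (u i) = C.length - 1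

/-- Taskwise joint alignment: `X(a) = Γ(a) (∑ᵢ λᵢ uᵢ(a) + d) + κ(a) 𝟏` for all `a`, where `Γ(a)` is
invertible and `λᵢ`, `d` do not depend on `a`. Here `uᵢ(a)` is the row vector
`θ ↦ uᵢ(aᵢ, θᵢ)`, and `Matrix.vecMulVec` is the product of a column with a row. -/
def TaskwiseJointlyAligned {ι : Type*} [Fintype ι] {A Θ : ι → Type*} {m : ℕ}
    (u : ∀ i, A i → Θ i → ℝ) (X : (∀ i, A i) → Matrix (Fin m) (∀ i, Θ i) ℝ) : Prop :=
  ∃ (d : Matrix (Fin m) (∀ i, Θ i) ℝ) (lam : ι → Fin m → ℝ)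
    (Γ : (∀ i, A i) → Matrix (Fin m) (Fin m) ℝ) (κ : (∀ i, A i) → Fin m → ℝ),
    (∀ a, IsUnit (Γ a)) ∧
      ∀ a, X a =
        Γ a * (∑ i, Matrix.vecMulVec (lam i) (fun θ : ∀ i, Θ i => u i (a i) (θ i)) + d)
          + Matrix.vecMulVec (κ a) (fun _ => 1)

end BeliefElicitation

open BeliefElicitation

namespace BeliefElicitation

/-! ### Expectations and optimal actions -/

section Expect

variable {Θ : Type*} [Fintype Θ]

/-! Sufficiency. Given the action, a quadratic score pays best for the true expected answers, with
maximum equal to the sum of their squares. This bonus may distort the choice of action, so a large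
multiple of the payoff is added. For aligned questions, a change of action moves the expected
answers by combinations of the losses of the component tasks. These losses are nonnegative at an
optimum, so the multiple outweighs the distortion (`incentivizable_of_gap`,
`incentivizable_of_linear`). Invertible affine recoding of answers restores `Γ` and `κ`, and `d`
absorbs perturbations.

Necessity. Put `Y a = (μ a)⁻¹ * X a`. For adjacent `a`, `b`, a perturbation makes the question at
`a` trivial and leaves `Y b - Y a` at `b`. Near a full-support belief where exactly these two
actions tie, the trivial report stays optimal along every tie-preserving direction. By linearity in
the belief, a report correct at `b` stays optimal too, so its correct value cannot move
(`Incentivizable.expect_eq_zero`). Hence each row of `Y b - Y a` is a multiple of the payoff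
difference, modulo constants.

It remains to make the multiples agree. A mixed second difference of `Y` in tasks `i` and `j`
depends, modulo constants, both on `θ i` alone and on `θ j` alone, so it vanishes: increments in
task `i` ignore the other actions. Within a task, the rank condition makes the multiple constant on
each basis cycle, and one-blockness extends this to all edges
(`IsOneBlock.exists_eq_of_cycleBasis`). Subtracting the resulting combination of the `u i` leaves a
matrix independent of the action modulo constants, which supplies `d` and `κ`. -/

theorem expect_eq_dotProduct (p v : Θ → ℝ) : expect p v = p ⬝ᵥ v := rfl

theorem expect_const {p : Θ → ℝ} (hp : p ∈ stdSimplex ℝ Θ) (c : ℝ) :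
    expect p (fun _ => c) = c := by
  simp [expect, ← Finset.sum_mul, hp.2]

theorem expect_mono {p : Θ → ℝ} (hp : p ∈ stdSimplex ℝ Θ) {v w : Θ → ℝ} (h : ∀ θ, v θ ≤ w θ) :
    expect p v ≤ expect p w :=
  Finset.sum_le_sum fun θ _ => mul_le_mul_of_nonneg_left (h θ) (hp.1 θ)

theorem abs_expect_le {p : Θ → ℝ} (hp : p ∈ stdSimplex ℝ Θ) {v : Θ → ℝ} {R : ℝ}
    (h : ∀ θ, |v θ| ≤ R) : |expect p v| ≤ R := by
  rw [abs_le]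
  constructor
  · rw [← expect_const hp (-R)]
    exact expect_mono hp fun θ => (abs_le.1 (h θ)).1
  · rw [← expect_const hp R]
    exact expect_mono hp fun θ => (abs_le.1 (h θ)).2

theorem exists_isOptimal {A : Type*} [Finite A] [Nonempty A] (u : A → Θ → ℝ) (p : Θ → ℝ) :
    ∃ a, IsOptimal u p a :=
  Finite.exists_max fun a => expect p (u a)

end Expect

/-! ### Affine recoding and quadratic scores -/

section Sufficiency

variable {A Θ : Type*} [Fintype Θ] {m : ℕ}

/-- Incentivizability is preserved by an action-dependent invertible affine change of the
questions. -/
theorem Incentivizable.affine {u : A → Θ → ℝ} {Q : A → Matrix (Fin m) Θ ℝ}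
    (hQ : Incentivizable u Q) (Γ : A → Matrix (Fin m) (Fin m) ℝ) (hΓ : ∀ a, IsUnit (Γ a))
    (κ : A → Fin m → ℝ) :
    Incentivizable u (fun a => Γ a * Q a + Matrix.vecMulVec (κ a) (fun _ => 1)) := by
  obtain ⟨V, hV, hmax⟩ := hQ
  have hdet : ∀ a, IsUnit (Γ a).det := fun a => (Matrix.isUnit_iff_isUnit_det _).1 (hΓ a)
  -- `S a` inverts the recoding of answers; a report is decoded before it is scored.
  set S : A → (Fin m → ℝ) → Fin m → ℝ := fun a r => ((Γ a)⁻¹).mulVec (r - κ a) with hS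
  have hSinv : ∀ a s, S a ((Γ a).mulVec s + κ a) = s := fun a s => by
    simp [hS, Matrix.mulVec_mulVec, Matrix.nonsing_inv_mul _ (hdet a)]
  have hSinv' : ∀ a r, (Γ a).mulVec (S a r) + κ a = r := fun a r => by
    simp [hS, Matrix.mulVec_mulVec, Matrix.mul_nonsing_inv _ (hdet a)]
  refine ⟨fun r a => V (S a r) a, fun r a θ => hV _ _ _, fun p hp => ?_⟩
  have hE : ∀ a, (fun k => expect p ((Γ a * Q a + Matrix.vecMulVec (κ a) (fun _ => 1) : Matrix (Fin m) Θ ℝ) k)) =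
      (Γ a).mulVec (fun k => expect p (Q a k)) + κ a := by
    intro a
    have h1 : ∀ M : Matrix (Fin m) Θ ℝ, (fun k => expect p (M k)) = M.mulVec p := fun M => by
      ext k
      simp [expect, Matrix.mulVec, dotProduct, mul_comm]
    rw [h1, h1, Matrix.add_mulVec, Matrix.mulVec_mulVec]
    congr 1
    ext k
    simp [Matrix.mulVec, dotProduct, Matrix.vecMulVec_apply, ← Finset.mul_sum, hp.2]
  ext ⟨r, a⟩
  have key := Set.ext_iff.1 (hmax p hp) (S a r, a)
  simp only [Set.mem_ofPred_eq] at key ⊢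
  rw [hE]
  have h2 : (S a r = fun k => expect p (Q a k)) ↔
      r = (Γ a).mulVec (fun k => expect p (Q a k)) + κ a := by
    constructor
    · intro h
      rw [← h, hSinv']
    · intro h
      rw [h, hSinv]
  rw [← h2, ← key]
  constructor
  · rintro h ⟨s, b⟩
    simpa [hSinv] using h ((Γ b).mulVec s + κ b, b)
  · rintro h ⟨s, b⟩
    exact h (S b s, b)

/-- A quadratic score incentivizes `Q` if adding the squared length of the expected answers to a
multiple of the payoff preserves the gaps between optimal and other actions. -/
theorem incentivizable_of_gap [Finite A] [Nonempty A] {u : A → Θ → ℝ}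
    {Q : A → Matrix (Fin m) Θ ℝ} {R c : ℝ} (hR : ∀ a k θ, |Q a k θ| ≤ R)
    (hgap : ∀ p ∈ stdSimplex ℝ Θ, ∀ a b, IsOptimal u p a →
      expect p (u a) - expect p (u b) ≤
        (c * expect p (u a) + ∑ k, expect p (Q a k) ^ 2) -
          (c * expect p (u b) + ∑ k, expect p (Q b k) ^ 2)) :
    Incentivizable u Q := by
  classical
  -- Completing the square, the expectation of `W s a` is a value of `a` minus the squared distance
  -- from `s` to the true answers.
  set W : (Fin m → ℝ) → A → Θ → ℝ :=
    fun s a θ => c * u a θ + ∑ k, (2 * s k * Q a k θ - s k ^ 2) with hW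
  obtain ⟨M, hM⟩ : ∃ M : ℝ, ∀ a θ, |u a θ| ≤ M := by
    obtain ⟨M, hM⟩ := (Set.finite_range fun x : A × Θ => |u x.1 x.2|).bddAbove
    exact ⟨M, fun a θ => hM ⟨(a, θ), rfl⟩⟩
  -- On the box of reports bounded by `R`, each quadratic term is at most `2R² + R²`. The extra `1`
  -- makes the rescaled score strictly positive, so reports outside the box, which get `0`, are
  -- never optimal.
  set K : ℝ := |c| * |M| + m * (3 * R ^ 2) + 1 with hK
  have hWK : ∀ s : Fin m → ℝ, (∀ k, |s k| ≤ R) → ∀ a θ, |W s a θ| < K := by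
    intro s hs a θ
    have h1 : |c * u a θ| ≤ |c| * |M| := by
      rw [abs_mul]
      exact mul_le_mul_of_nonneg_left ((hM a θ).trans (le_abs_self M)) (abs_nonneg c)
    have h2 : |∑ k, (2 * s k * Q a k θ - s k ^ 2)| ≤ m * (3 * R ^ 2) := by
      refine (Finset.abs_sum_le_sum_abs _ _).trans ?_
      have : ∀ k ∈ Finset.univ, |2 * s k * Q a k θ - s k ^ 2| ≤ 3 * R ^ 2 := by
        intro k _
        refine (abs_sub _ _).trans ?_
        rw [abs_mul, abs_mul, abs_two, abs_pow]
        have h3 := hs k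
        have h4 := hR a k θ
        have h5 := abs_nonneg (s k)
        have h6 := abs_nonneg (Q a k θ)
        nlinarith [mul_le_mul h3 h4 h6 (h5.trans h3), mul_le_mul h3 h3 h5 (h5.trans h3)]
      simpa using Finset.sum_le_card_nsmul _ _ _ this
    have h3 := abs_add_le (c * u a θ) (∑ k, (2 * s k * Q a k θ - s k ^ 2))
    simp only [hW, hK]
    linarith
  have hK0 : 0 < K := by positivity
  refine ⟨fun s a θ => if ∀ k, |s k| ≤ R then (W s a θ + K) / (2 * K) else 0, ?_, ?_⟩
  · intro s a θ
    dsimp only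
    split_ifs with hs
    · have := abs_lt.1 (hWK s hs a θ)
      constructor
      · exact div_nonneg (by linarith) (by linarith)
      · rw [div_le_one (by linarith)]
        linarith
    · simp
  intro p hp
  set y : A → Fin m → ℝ := fun a k => expect p (Q a k) with hy
  have hyR : ∀ a k, |y a k| ≤ R := fun a k => abs_expect_le hp (hR a k)
  set v : A → ℝ := fun a => c * expect p (u a) + ∑ k, y a k ^ 2 with hv
  set G : (Fin m → ℝ) → A → ℝ := fun s a =>
    expect p (fun θ => if ∀ k, |s k| ≤ R then (W s a θ + K) / (2 * K) else 0) with hG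
  have hEW : ∀ s a, expect p (W s a) = v a - ∑ k, (s k - y a k) ^ 2 := by
    intro s a
    have h1 : expect p (W s a) = c * expect p (u a) + ∑ k, (2 * s k * y a k - s k ^ 2) := by
      have e1 : ∀ θ, p θ * W s a θ = c * (p θ * u a θ) +
          ∑ k, (2 * s k * (p θ * Q a k θ) - p θ * s k ^ 2) := fun θ => by
        simp only [hW, mul_add, Finset.mul_sum]
        congr 1
        · ring
        · exact Finset.sum_congr rfl fun k _ => by ring
      simp only [expect, hy]
      rw [Finset.sum_congr rfl fun θ _ => e1 θ, Finset.sum_add_distrib, ← Finset.mul_sum,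
        Finset.sum_comm]
      congr 1
      refine Finset.sum_congr rfl fun k _ => ?_
      rw [Finset.sum_sub_distrib, ← Finset.mul_sum, ← Finset.sum_mul, hp.2, one_mul]
    rw [h1, hv]
    dsimp only
    rw [add_sub_assoc, ← Finset.sum_sub_distrib]
    congr 1
    exact Finset.sum_congr rfl fun k _ => by ring
  have hGin : ∀ s a, (∀ k, |s k| ≤ R) →
      G s a = (v a - ∑ k, (s k - y a k) ^ 2 + K) / (2 * K) := by
    intro s a hs
    rw [← hEW]
    simp only [hG, if_pos hs]
    have : expect p (W s a) + K = ∑ θ, p θ * (W s a θ + K) := by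
      simp only [mul_add, Finset.sum_add_distrib, ← Finset.sum_mul, hp.2, one_mul, expect]
    rw [this, Finset.sum_div]
    exact Finset.sum_congr rfl fun θ _ => by ring
  have hGout : ∀ s a, ¬ (∀ k, |s k| ≤ R) → G s a = 0 := by
    intro s a hs
    simp only [hG, if_neg hs, expect_const hp]
  have hGy : ∀ a, G (y a) a = (v a + K) / (2 * K) := fun a => by
    simp [hGin _ a (hyR a)]
  have hpos : ∀ a, 0 < (v a + K) / (2 * K) := by
    intro a
    have h1 : |expect p (W (y a) a)| < K := by
      obtain ⟨θ₀, -, hθ₀⟩ : ∃ θ ∈ Finset.univ, p θ ≠ 0 := by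
        apply Finset.exists_ne_zero_of_sum_ne_zero
        rw [hp.2]
        exact one_ne_zero
      have : Nonempty Θ := ⟨θ₀⟩
      obtain ⟨θ₁, h₁⟩ := Finite.exists_max fun θ => |W (y a) a θ|
      exact (abs_expect_le hp h₁).trans_lt (hWK _ (hyR a) a θ₁)
    rw [hEW] at h1
    have h2 := (abs_lt.1 h1).1
    simp only [sub_self, ne_eq, OfNat.ofNat_ne_zero, not_false_eq_true, zero_pow,
      Finset.sum_const_zero, sub_zero] at h2
    exact div_pos (by linarith) (by linarith)
  have hGle : ∀ s a, G s a ≤ (v a + K) / (2 * K) := by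
    intro s a
    by_cases hs : ∀ k, |s k| ≤ R
    · rw [hGin s a hs, div_le_div_iff_of_pos_right (by linarith)]
      have : 0 ≤ ∑ k, (s k - y a k) ^ 2 := Finset.sum_nonneg fun k _ => sq_nonneg _
      linarith
    · rw [hGout s a hs]
      exact (hpos a).le
  have hGeq : ∀ s a, G s a = (v a + K) / (2 * K) → s = y a := by
    intro s a h
    by_cases hs : ∀ k, |s k| ≤ R
    · rw [hGin s a hs, div_left_inj' (by linarith)] at h
      have h0 : ∑ k, (s k - y a k) ^ 2 = 0 := by linarith
      rw [Finset.sum_eq_zero_iff_of_nonneg fun k _ => sq_nonneg _] at h0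
      ext k
      have := pow_eq_zero_iff (two_ne_zero) |>.1 (h0 k (Finset.mem_univ k))
      linarith
    · rw [hGout s a hs] at h
      exact absurd h (hpos a).ne
  have hvle : ∀ a b, IsOptimal u p a → v b ≤ v a := by
    intro a b ha
    have h1 := hgap p hp a b ha
    have h2 := ha b
    simp only [hv, hy]
    linarith
  ext ⟨s, a⟩
  simp only [Set.mem_ofPred_eq]
  change (∀ x : (Fin m → ℝ) × A, G x.1 x.2 ≤ G s a) ↔ IsOptimal u p a ∧ s = y a
  constructor
  · intro h
    obtain ⟨a₀, ha₀⟩ := exists_isOptimal u p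
    have h1 := h (y a₀, a₀)
    have h2 := hGle s a
    simp only [hGy] at h1
    have h3 : v a₀ ≤ v a := by
      have := h1.trans h2
      rw [div_le_div_iff_of_pos_right (by linarith)] at this
      linarith
    -- `a` has at least the value of the optimal `a₀`, so the gap inequality forces their payoffs to
    -- agree.
    have h4 := hgap p hp a₀ a ha₀
    refine ⟨fun b => (ha₀ b).trans ?_, hGeq s a (le_antisymm h2 ?_)⟩
    · simp only [hv, hy] at h3
      linarith
    · have := h (y a, a)
      simpa only [hGy] using this
  · rintro ⟨ha, rfl⟩ ⟨s, b⟩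
    refine (hGle s b).trans ?_
    rw [hGy, div_le_div_iff_of_pos_right (by linarith)]
    linarith [hvle a b ha]

end Sufficiency

/-! ### Aligned questions in a product task -/

section ProductSufficiency

variable {ι : Type*} [Fintype ι] [DecidableEq ι] {A Θ : ι → Type*}
  [∀ i, Fintype (A i)] [∀ i, Fintype (Θ i)] {m : ℕ}

omit [∀ i, Fintype (A i)] in
theorem expect_productPayoff (u : ∀ i, A i → Θ i → ℝ) (p : (∀ i, Θ i) → ℝ) (a : ∀ i, A i) :
    expect p (productPayoff u a) = ∑ i, expect p (fun θ => u i (a i) (θ i)) := by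
  simp only [expect, productPayoff, Finset.mul_sum]
  exact Finset.sum_comm

omit [∀ i, Fintype (A i)] in
-- Payoffs add over tasks, so a deviation in one task affects only that summand.
theorem IsOptimal.component_le {u : ∀ i, A i → Θ i → ℝ} {p : (∀ i, Θ i) → ℝ} {a : ∀ i, A i}
    (h : IsOptimal (productPayoff u) p a) (i : ι) (x : A i) :
    expect p (fun θ => u i x (θ i)) ≤ expect p (fun θ => u i (a i) (θ i)) := by
  have h1 := h (Function.update a i x)
  rw [expect_productPayoff, expect_productPayoff,
    ← Finset.add_sum_erase _ _ (Finset.mem_univ i),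
    ← Finset.add_sum_erase (a := i) _ (fun i => expect p fun θ => u i (a i) (θ i))
      (Finset.mem_univ i), Function.update_self] at h1
  have h2 : ∑ j ∈ Finset.univ.erase i, expect p (fun θ => u j (Function.update a i x j) (θ j)) =
      ∑ j ∈ Finset.univ.erase i, expect p (fun θ => u j (a j) (θ j)) :=
    Finset.sum_congr rfl fun j hj => by
      rw [Function.update_of_ne (Finset.ne_of_mem_erase hj)]
  linarith

theorem incentivizable_of_linear [∀ i, Nonempty (A i)] (u : ∀ i, A i → Θ i → ℝ)
    (d : Matrix (Fin m) (∀ i, Θ i) ℝ) (lam : ι → Fin m → ℝ) :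
    Incentivizable (productPayoff u) (fun a =>
      ∑ i, Matrix.vecMulVec (lam i) (fun θ : ∀ i, Θ i => u i (a i) (θ i)) + d) := by
  set Q : (∀ i, A i) → Matrix (Fin m) (∀ i, Θ i) ℝ := fun a =>
    ∑ i, Matrix.vecMulVec (lam i) (fun θ : ∀ i, Θ i => u i (a i) (θ i)) + d with hQ
  obtain ⟨R, hR⟩ : ∃ R : ℝ, ∀ a k θ, |Q a k θ| ≤ R := by
    obtain ⟨M, hM⟩ :=
      (Set.finite_range fun x : (∀ i, A i) × Fin m × (∀ i, Θ i) => |Q x.1 x.2.1 x.2.2|).bddAbove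
    exact ⟨M, fun a k θ => hM ⟨(a, k, θ), rfl⟩⟩
  -- The sum bounds how fast the squared answers can grow per unit of payoff loss, via a difference
  -- of squares with second factor at most `2|R|`. The summand `1` preserves the payoff gap itself.
  refine incentivizable_of_gap (R := R) (c := 1 + ∑ i, ∑ k, |lam i k| * (2 * |R|)) hR ?_
  intro p hp a b ha
  set c₀ := ∑ i, ∑ k, |lam i k| * (2 * |R|) with hc₀
  set δ : ι → ℝ := fun i =>
    expect p (fun θ => u i (a i) (θ i)) - expect p (fun θ => u i (b i) (θ i)) with hδ
  have hδ0 : ∀ i, 0 ≤ δ i := fun i => sub_nonneg.2 (ha.component_le i (b i))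
  have hU : expect p (productPayoff u a) - expect p (productPayoff u b) = ∑ i, δ i := by
    rw [expect_productPayoff, expect_productPayoff, ← Finset.sum_sub_distrib]
  have hEQ : ∀ a k, expect p (Q a k) =
      ∑ i, lam i k * expect p (fun θ => u i (a i) (θ i)) + expect p (d k) := by
    intro a k
    have e1 : ∀ θ, p θ * Q a k θ =
        ∑ i, lam i k * (p θ * u i (a i) (θ i)) + p θ * d k θ := fun θ => by
      simp only [hQ, Matrix.add_apply, Matrix.sum_apply, Matrix.vecMulVec_apply, mul_add,
        Finset.mul_sum]
      congr 1
      exact Finset.sum_congr rfl fun i _ => by ring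
    simp only [expect]
    rw [Finset.sum_congr rfl fun θ _ => e1 θ, Finset.sum_add_distrib, Finset.sum_comm]
    simp only [Finset.mul_sum]
  have hdiff : ∀ k, expect p (Q a k) - expect p (Q b k) = ∑ i, lam i k * δ i := fun k => by
    rw [hEQ, hEQ, add_sub_add_right_eq_sub, ← Finset.sum_sub_distrib]
    exact Finset.sum_congr rfl fun i _ => by simp only [hδ]; ring
  have hk : ∀ k, -(∑ i, |lam i k| * (2 * |R|) * δ i) ≤
      expect p (Q a k) ^ 2 - expect p (Q b k) ^ 2 := by
    intro k
    have h1 : |∑ i, lam i k * δ i| ≤ ∑ i, |lam i k| * δ i :=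
      (Finset.abs_sum_le_sum_abs _ _).trans
        (Finset.sum_le_sum fun i _ => by rw [abs_mul, abs_of_nonneg (hδ0 i)])
    have h2 : |expect p (Q a k) + expect p (Q b k)| ≤ 2 * |R| := by
      have h3 := abs_expect_le hp (hR a k)
      have h4 := abs_expect_le hp (hR b k)
      have h5 := abs_add_le (expect p (Q a k)) (expect p (Q b k))
      linarith [le_abs_self R]
    have h3 : expect p (Q a k) ^ 2 - expect p (Q b k) ^ 2 =
        (∑ i, lam i k * δ i) * (expect p (Q a k) + expect p (Q b k)) := by
      rw [← hdiff]
      ring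
    have h4 : |expect p (Q a k) ^ 2 - expect p (Q b k) ^ 2| ≤
        (∑ i, |lam i k| * δ i) * (2 * |R|) := by
      rw [h3, abs_mul]
      exact mul_le_mul h1 h2 (abs_nonneg _) ((abs_nonneg _).trans h1)
    have h5 : (∑ i, |lam i k| * δ i) * (2 * |R|) = ∑ i, |lam i k| * (2 * |R|) * δ i := by
      rw [Finset.sum_mul]
      exact Finset.sum_congr rfl fun i _ => by ring
    rw [← h5]
    exact (abs_le.1 h4).1
  have hsum : -(∑ i, c₀ * δ i) ≤ ∑ k, expect p (Q a k) ^ 2 - ∑ k, expect p (Q b k) ^ 2 := by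
    rw [← Finset.sum_sub_distrib]
    refine le_trans ?_ (Finset.sum_le_sum fun k _ => hk k)
    rw [Finset.sum_neg_distrib, neg_le_neg_iff, Finset.sum_comm]
    refine Finset.sum_le_sum fun i _ => ?_
    rw [← Finset.sum_mul]
    refine mul_le_mul_of_nonneg_right ?_ (hδ0 i)
    exact Finset.single_le_sum (f := fun i => ∑ k, |lam i k| * (2 * |R|))
      (fun i _ => Finset.sum_nonneg fun k _ => by positivity) (Finset.mem_univ i)
  rw [← Finset.mul_sum, ← hU] at hsum
  nlinarith [hsum]

/-- With `μ = Γ`, the perturbation by `t` merely replaces `d` by `d + t`. -/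
theorem TaskwiseJointlyAligned.robustlyIncentivizable [∀ i, Nonempty (A i)]
    {u : ∀ i, A i → Θ i → ℝ} {X : (∀ i, A i) → Matrix (Fin m) (∀ i, Θ i) ℝ}
    (h : TaskwiseJointlyAligned u X) : RobustlyIncentivizable (productPayoff u) X := by
  obtain ⟨d, lam, Γ, κ, hΓ, hX⟩ := h
  refine ⟨Γ, hΓ, fun t => ?_⟩
  convert (incentivizable_of_linear u (d + t) lam).affine Γ hΓ κ using 2 with a
  rw [hX, ← add_assoc, Matrix.mul_add _ _ t, add_right_comm]

end ProductSufficiency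

open Filter Topology

/-! ### Increments of the questions along an edge -/

section Necessity

variable {A Θ : Type*} [Fintype Θ] {m : ℕ}

/-- A vector which is zero or takes values of both signs is annihilated by a belief of full
support. -/
theorem exists_pos_expect_eq_zero [Nonempty Θ] {D : Θ → ℝ} (h₁ : (∀ θ, D θ ≤ 0) → D = 0)
    (h₂ : (∀ θ, 0 ≤ D θ) → D = 0) :
    ∃ q ∈ stdSimplex ℝ Θ, (∀ θ, 0 < q θ) ∧ expect q D = 0 := by
  classical
  suffices h : ∃ w : Θ → ℝ, (∀ θ, 0 < w θ) ∧ ∑ θ, w θ * D θ = 0 by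
    obtain ⟨w, hw, hwD⟩ := h
    have hs : 0 < ∑ θ, w θ := Finset.sum_pos (fun θ _ => hw θ) Finset.univ_nonempty
    refine ⟨fun θ => w θ / ∑ θ, w θ, ⟨fun θ => (div_pos (hw θ) hs).le, ?_⟩,
      fun θ => div_pos (hw θ) hs, ?_⟩
    · rw [← Finset.sum_div, div_self hs.ne']
    · simp only [expect, div_mul_eq_mul_div]
      rw [← Finset.sum_div, hwD, zero_div]
  have key : ∀ θ₀, D θ₀ ≠ 0 → 0 ≤ -(∑ θ, D θ) / D θ₀ →
      ∃ w : Θ → ℝ, (∀ θ, 0 < w θ) ∧ ∑ θ, w θ * D θ = 0 := by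
    intro θ₀ h0 hle
    -- Uniform weights, with the weight raised at one state whose sign opposes the total, just
    -- enough to cancel it.
    refine ⟨fun θ => 1 + if θ = θ₀ then -(∑ θ, D θ) / D θ₀ else 0, fun θ => ?_, ?_⟩
    · dsimp only
      split_ifs <;> linarith
    · simp only [add_mul, one_mul, ite_mul, zero_mul, Finset.sum_add_distrib,
        Finset.sum_ite_eq', Finset.mem_univ, if_true]
      field_simp
      ring
  by_cases hD : D = 0
  · exact ⟨fun _ => 1, fun _ => one_pos, by simp [hD]⟩
  obtain ⟨x, hx⟩ : ∃ θ, 0 < D θ := by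
    by_contra! h
    exact hD (h₁ h)
  obtain ⟨y, hy⟩ : ∃ θ, D θ < 0 := by
    by_contra! h
    exact hD (h₂ h)
  rcases le_total 0 (∑ θ, D θ) with hS | hS
  · exact key y hy.ne (div_nonneg_of_nonpos (by linarith) hy.le)
  · exact key x hx.ne' (div_nonneg (by linarith) hx.le)

theorem expect_add_smul (p x v : Θ → ℝ) (ε : ℝ) :
    expect (p + ε • x) v = expect p v + ε * expect x v := by
  simp only [expect_eq_dotProduct, add_dotProduct, smul_dotProduct, smul_eq_mul]

/-- If exactly `a` and `b` are optimal under `p` then this remains so when `p` is moved slightly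
in a direction along which `a` and `b` remain equally good. -/
theorem eventually_isOptimal_iff [Finite A] {u : A → Θ → ℝ} {p x : Θ → ℝ} {a b : A}
    (hopt : ∀ c, IsOptimal u p c ↔ c = a ∨ c = b) (hx : expect x (u a) = expect x (u b)) :
    ∀ᶠ ε : ℝ in 𝓝 0, ∀ c, IsOptimal u (p + ε • x) c ↔ c = a ∨ c = b := by
  have ha : IsOptimal u p a := (hopt a).2 (Or.inl rfl)
  have hb : IsOptimal u p b := (hopt b).2 (Or.inr rfl)
  have hab : expect p (u a) = expect p (u b) := le_antisymm (hb a) (ha b)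
  have h1 : ∀ᶠ ε : ℝ in 𝓝 0, ∀ c, ¬ (c = a ∨ c = b) →
      expect (p + ε • x) (u c) < expect (p + ε • x) (u a) := by
    rw [eventually_all]
    intro c
    by_cases hc : c = a ∨ c = b
    · simp [hc]
    have h2 : expect p (u c) < expect p (u a) := by
      by_contra! h
      exact hc ((hopt c).1 fun d => (ha d).trans h)
    simp only [expect_add_smul]
    have h3 : ∀ v : Θ → ℝ, Tendsto (fun ε : ℝ => expect p v + ε * expect x v) (𝓝 0)
        (𝓝 (expect p v)) := fun v => by
      have : Continuous fun ε : ℝ => expect p v + ε * expect x v := by fun_prop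
      simpa using this.tendsto 0
    filter_upwards [(h3 (u c)).eventually_lt (h3 (u a)) h2] with ε hε _ using hε
  filter_upwards [h1] with ε hε c
  have hab' : expect (p + ε • x) (u a) = expect (p + ε • x) (u b) := by
    rw [expect_add_smul, expect_add_smul, hab, hx]
  have hale : ∀ d, expect (p + ε • x) (u d) ≤ expect (p + ε • x) (u a) := by
    intro d
    by_cases hd : d = a ∨ d = b
    · rcases hd with rfl | rfl
      · exact le_rfl
      · exact hab'.ge
    · exact (hε d hd).le
  constructor
  · intro hc
    by_contra h
    exact absurd (hc a) (not_le.2 (hε c h))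
  · rintro (rfl | rfl)
    · exact hale
    · exact fun d => (hale d).trans hab'.le

/-- Without dominance some full-support belief `q` makes `a` and `b` tie; a small move from the
adjacency belief towards `q` keeps all other actions suboptimal. -/
theorem exists_pos_belief_of_adj [Finite A] [Nonempty Θ] {u : A → Θ → ℝ} {a b : A}
    (hadj : (adjacencyGraph u).Adj a b) (hab : (∀ θ, u a θ ≤ u b θ) → u a = u b)
    (hba : (∀ θ, u b θ ≤ u a θ) → u b = u a) :
    ∃ p ∈ stdSimplex ℝ Θ, (∀ θ, 0 < p θ) ∧ ∀ c, IsOptimal u p c ↔ c = a ∨ c = b := by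
  obtain ⟨-, p, hp, hopt⟩ := hadj
  obtain ⟨q, hq, hqpos, hqD⟩ := exists_pos_expect_eq_zero (D := u b - u a)
    (fun h => sub_eq_zero.2 (hba fun θ => sub_nonpos.1 (h θ)))
    (fun h => sub_eq_zero.2 (hab fun θ => sub_nonneg.1 (h θ)).symm)
  have hp' : expect p (u a) = expect p (u b) :=
    le_antisymm ((hopt b).2 (Or.inr rfl) a) ((hopt a).2 (Or.inl rfl) b)
  have hx : expect (q - p) (u a) = expect (q - p) (u b) := by
    simp only [expect_eq_dotProduct, sub_dotProduct, dotProduct_sub] at *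
    linarith
  have hev := (eventually_isOptimal_iff hopt hx).filter_mono (nhdsWithin_le_nhds (s := Set.Ioi 0))
  have hIoo : ∀ᶠ ε : ℝ in 𝓝[>] 0, ε ∈ Set.Ioo (0 : ℝ) 1 := Ioo_mem_nhdsGT one_pos
  obtain ⟨ε, hε, hε0, hε1⟩ := (hev.and hIoo).exists
  have e : ∀ θ, (p + ε • (q - p)) θ = (1 - ε) * p θ + ε * q θ := fun θ => by
    simp only [Pi.add_apply, Pi.smul_apply, Pi.sub_apply, smul_eq_mul]
    ring
  have hpos : ∀ θ, 0 < (p + ε • (q - p)) θ := fun θ => by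
    rw [e]
    exact add_pos_of_nonneg_of_pos (mul_nonneg (by linarith) (hp.1 θ)) (mul_pos hε0 (hqpos θ))
  refine ⟨p + ε • (q - p), ⟨fun θ => (hpos θ).le, ?_⟩, hpos, hε⟩
  simp only [e, Finset.sum_add_distrib, ← Finset.mul_sum, hp.2, hq.2]
  ring

/-- If the question asked at `a` is trivial then the question asked at an adjacent action `b`
cannot separate beliefs at which `a` and `b` are equally good. -/
theorem Incentivizable.expect_eq_zero [Finite A] {u : A → Θ → ℝ} {X : A → Matrix (Fin m) Θ ℝ}
    (hX : Incentivizable u X) {a b : A} {p : Θ → ℝ} (hp : p ∈ stdSimplex ℝ Θ)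
    (hpos : ∀ θ, 0 < p θ) (hopt : ∀ c, IsOptimal u p c ↔ c = a ∨ c = b) (ha : X a = 0)
    {x : Θ → ℝ} (hx : ∑ θ, x θ = 0) (hxu : expect x (u a) = expect x (u b)) (k : Fin m) :
    expect x (X b k) = 0 := by
  obtain ⟨V, -, hmax⟩ := hX
  have hposε : ∀ᶠ ε : ℝ in 𝓝 0, ∀ θ, 0 < (p + ε • x) θ := by
    rw [eventually_all]
    intro θ
    have : Continuous fun ε : ℝ => (p + ε • x) θ := by
      simp only [Pi.add_apply, Pi.smul_apply]
      fun_prop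
    exact this.tendsto 0 |>.eventually_const_lt (by simpa using hpos θ)
  have hev := hposε.and (eventually_isOptimal_iff hopt hxu)
  have hneg : Tendsto (fun ε : ℝ => -ε) (𝓝 0) (𝓝 0) := by
    simpa using (continuous_neg (G := ℝ)).tendsto 0
  obtain ⟨ε, ⟨h₁, h₂⟩, hε⟩ := ((hev.and (hneg.eventually hev)).filter_mono
    (nhdsWithin_le_nhds (s := Set.Ioi (0 : ℝ)))).and self_mem_nhdsWithin |>.exists
  have hε0 : (0 : ℝ) < ε := hε
  have hmem : ∀ η : ℝ, (∀ θ, 0 < (p + η • x) θ) → p + η • x ∈ stdSimplex ℝ Θ := fun η h =>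
    ⟨fun θ => (h θ).le, by simp [Finset.sum_add_distrib, ← Finset.mul_sum, hx, hp.2]⟩
  set r : Fin m → ℝ := fun k => expect p (X b k) with hr
  have hzero : ∀ q : Θ → ℝ, (fun k => expect q (X a k)) = 0 := fun q => by
    ext k
    simp [ha, expect]
  have hamax : ∀ q ∈ stdSimplex ℝ Θ, (∀ c, IsOptimal u q c ↔ c = a ∨ c = b) → ∀ s c,
      expect q (V s c) ≤ expect q (V 0 a) := by
    intro q hq ho s c
    have := (Set.ext_iff.1 (hmax q hq) (0, a)).2 ⟨(ho a).2 (Or.inl rfl), (hzero q).symm⟩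
    exact this (s, c)
  have hbmax : expect p (V 0 a) ≤ expect p (V r b) :=
    (Set.ext_iff.1 (hmax p hp) (r, b)).2 ⟨(hopt b).2 (Or.inr rfl), rfl⟩ (0, a)
  have e0 := hamax p hp hopt r b
  have e1 := hamax _ (hmem _ h₁.1) h₁.2 r b
  have e2 := hamax _ (hmem _ h₂.1) h₂.2 r b
  simp only [expect_add_smul] at e1 e2
  -- The advantage of `(r, b)` over `(0, a)` is affine in the step, zero at `p` and nonpositive at
  -- both `ε` and `-ε`, hence zero.
  have e3 : expect (p + ε • x) (V r b) = expect (p + ε • x) (V 0 a) := by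
    simp only [expect_add_smul]
    linarith
  have hopt' : ((r, b) : (Fin m → ℝ) × A) ∈ {y : (Fin m → ℝ) × A |
      IsOptimal u (p + ε • x) y.2 ∧ y.1 = fun k => expect (p + ε • x) (X y.2 k)} := by
    rw [← hmax _ (hmem _ h₁.1)]
    rintro ⟨s, c⟩
    exact (hamax _ (hmem _ h₁.1) h₁.2 s c).trans e3.ge
  have e4 := congrFun hopt'.2 k
  simp only [hr, expect_add_smul] at e4
  have : ε * expect x (X b k) = 0 := by linarith
  exact (mul_eq_zero.1 this).resolve_left hε0.ne'

theorem sum_centered [Nonempty Θ] (v : Θ → ℝ) : ∑ θ, centered v θ = 0 := by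
  simp only [centered, Finset.sum_sub_distrib, Finset.sum_const, Finset.card_univ, nsmul_eq_mul]
  field_simp
  ring

theorem centered_add (v w : Θ → ℝ) : centered (v + w) = centered v + centered w := by
  ext θ
  simp only [centered, Pi.add_apply, Finset.sum_add_distrib]
  ring

theorem centered_smul (c : ℝ) (v : Θ → ℝ) : centered (c • v) = c • centered v := by
  ext θ
  simp only [centered, Pi.smul_apply, smul_eq_mul, ← Finset.mul_sum]
  ring

/-- Centering as a linear map. -/
noncomputable def centeredLin : (Θ → ℝ) →ₗ[ℝ] (Θ → ℝ) where
  toFun := centered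
  map_add' := centered_add
  map_smul' := centered_smul

theorem centeredLin_apply (v : Θ → ℝ) : centeredLin v = centered v := rfl

theorem centeredLin_eq_zero_iff [Nonempty Θ] {v : Θ → ℝ} :
    centeredLin v = 0 ↔ ∀ θ θ', v θ = v θ' := by
  constructor
  · intro h θ θ'
    have h1 := congrFun h θ
    have h2 := congrFun h θ'
    simp only [centeredLin_apply, centered, Pi.zero_apply] at h1 h2
    linarith
  · intro h
    ext θ
    simp only [centeredLin_apply, centered, Pi.zero_apply]
    rw [Finset.sum_congr rfl fun θ' _ => h θ' θ]
    simp

theorem expect_centeredLin {x : Θ → ℝ} (hx : ∑ θ, x θ = 0) (v : Θ → ℝ) :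
    expect x (centeredLin v) = expect x v := by
  simp only [expect, centeredLin_apply, centered, mul_sub, Finset.sum_sub_distrib,
    ← Finset.sum_mul, hx, zero_mul, sub_zero]

/-- A vector that annihilates the directions of sum zero orthogonal to `D` is a multiple of `D` up
to constants. -/
theorem centeredLin_eq_smul [Nonempty Θ] {w D : Θ → ℝ}
    (h : ∀ x : Θ → ℝ, ∑ θ, x θ = 0 → expect x D = 0 → expect x w = 0) :
    centeredLin w = (expect (centeredLin D) (centeredLin w) /
      expect (centeredLin D) (centeredLin D)) • centeredLin D := by
  set d := centeredLin D with hd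
  set w' := centeredLin w with hw'
  have hsd : ∑ θ, d θ = 0 := sum_centered D
  have hsw : ∑ θ, w' θ = 0 := sum_centered w
  -- Orthogonal projection coefficient; if `d = 0` the quotient defaults to `0`, which is harmless.
  set c := expect d w' / expect d d with hc
  set x := w' - c • d with hx
  have hsx : ∑ θ, x θ = 0 := by
    simp [hx, Finset.sum_sub_distrib, ← Finset.mul_sum, hsd, hsw]
  have hxd : expect x d = 0 := by
    by_cases h0 : d ⬝ᵥ d = 0
    · rw [dotProduct_self_eq_zero.1 h0]
      simp [expect]
    · simp only [hx, hc, expect_eq_dotProduct, sub_dotProduct, smul_dotProduct, smul_eq_mul]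
      rw [div_mul_cancel₀ _ h0, dotProduct_comm, sub_self]
  have hxw : expect x w' = 0 := by
    rw [hw', expect_centeredLin hsx]
    exact h x hsx (by rw [← expect_centeredLin hsx]; exact hxd)
  have hxx : x ⬝ᵥ x = 0 := by
    have : x ⬝ᵥ x = expect x w' - c * expect x d := by
      conv_lhs => rw [hx]
      simp only [dotProduct_sub, dotProduct_smul, smul_eq_mul, expect_eq_dotProduct, hx]
    rw [this, hxw, hxd]
    ring
  exact sub_eq_zero.1 (dotProduct_self_eq_zero.1 hxx)

/-- Along an edge of the adjacency graph, the questions normalized by the matrices of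
robust incentivizability change by multiples of the payoff difference, up to constants. -/
theorem centeredLin_sub_eq_smul_of_adj [Finite A] [Nonempty Θ] {u : A → Θ → ℝ}
    {X : A → Matrix (Fin m) Θ ℝ} {μ : A → Matrix (Fin m) (Fin m) ℝ} (hμ : ∀ a, IsUnit (μ a))
    (hX : ∀ t : Matrix (Fin m) Θ ℝ, Incentivizable u (fun a => X a + μ a * t)) {a b : A}
    (hadj : (adjacencyGraph u).Adj a b) (hab : (∀ θ, u a θ ≤ u b θ) → u a = u b)
    (hba : (∀ θ, u b θ ≤ u a θ) → u b = u a) (k : Fin m) :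
    centeredLin (((μ b)⁻¹ * X b) k - ((μ a)⁻¹ * X a) k) =
      (expect (centeredLin (u b - u a)) (centeredLin (((μ b)⁻¹ * X b) k - ((μ a)⁻¹ * X a) k)) /
        expect (centeredLin (u b - u a)) (centeredLin (u b - u a))) •
        centeredLin (u b - u a) := by
  have hdet : ∀ a, IsUnit (μ a).det := fun a => (Matrix.isUnit_iff_isUnit_det _).1 (hμ a)
  obtain ⟨p, hp, hpos, hopt⟩ := exists_pos_belief_of_adj hadj hab hba
  apply centeredLin_eq_smul
  intro x hx hxD
  -- This perturbation kills the question at `a`; multiplying by the inverses then leaves the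
  -- difference of normalized questions at `b`.
  have hinc := (hX (-((μ a)⁻¹ * X a))).affine (fun a => (μ a)⁻¹)
    (fun a => (Matrix.isUnit_nonsing_inv_iff).2 (hμ a)) 0
  have key := hinc.expect_eq_zero hp hpos hopt (a := a) (b := b) ?_ hx ?_ k
  · convert key using 2
    ext θ
    simp only [Pi.zero_apply, Matrix.zero_vecMulVec, add_zero, Matrix.mul_add, Matrix.mul_neg]
    rw [Matrix.nonsing_inv_mul_cancel_left _ _ (hdet b)]
    simp [sub_eq_add_neg]
  · simp only [Pi.zero_apply, Matrix.zero_vecMulVec, add_zero, Matrix.mul_add, Matrix.mul_neg]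
    rw [Matrix.nonsing_inv_mul_cancel_left _ _ (hdet a), add_neg_cancel]
  · simp only [expect_eq_dotProduct, dotProduct_sub] at hxD ⊢
    linarith

end Necessity

/-! ### Circulations and labellings constant on cycles -/

section Graph

variable {V : Type*} {G : SimpleGraph V}

theorem sum_darts_sub {M : Type*} [AddCommGroup M] (g : V → M) {x y : V} (p : G.Walk x y) :
    (p.darts.map fun e => g e.snd - g e.fst).sum = g y - g x := by
  induction p with
  | nil => simp
  | cons h p ih => simp [ih]

/-- If the vectors `f e`, `e ∈ l`, sum to zero and have rank one less than the length of `l`, then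
every linear relation among them has constant coefficients. -/
theorem eq_of_finrank_eq_length_sub_one {α M : Type*} [AddCommGroup M] [Module ℝ M] {l : List α}
    (hl : l ≠ []) {f : α → M}
    (hrank : Set.finrank ℝ {x : M | ∃ e ∈ l, x = f e} = l.length - 1)
    (hsum : (l.map f).sum = 0) {c : α → ℝ} (hc : (l.map fun e => c e • f e).sum = 0)
    {e e' : α} (he : e ∈ l) (he' : e' ∈ l) : c e = c e' := by
  set F := Fintype.linearCombination ℝ (fun i : Fin l.length => f l[i.1]) with hF
  have hrange : {x : M | ∃ e ∈ l, x = f e} = Set.range fun i : Fin l.length => f l[i.1] := by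
    ext x
    constructor
    · rintro ⟨e, he, rfl⟩
      obtain ⟨i, hi, rfl⟩ := List.getElem_of_mem he
      exact ⟨⟨i, hi⟩, rfl⟩
    · rintro ⟨i, rfl⟩
      exact ⟨_, List.getElem_mem i.2, rfl⟩
  have hlen : 0 < l.length := List.length_pos_of_ne_nil hl
  -- Rank-nullity; positivity of the length makes the truncated subtraction harmless. The all-ones
  -- relation therefore spans all relations.
  have hker : Module.finrank ℝ (LinearMap.ker F) = 1 := by
    have h1 := LinearMap.finrank_range_add_finrank_ker F
    rw [hF, Fintype.range_linearCombination, ← hF, ← hrange] at h1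
    rw [Set.finrank] at hrank
    rw [hrank, Module.finrank_fin_fun] at h1
    omega
  have hone : (fun _ => 1 : Fin l.length → ℝ) ∈ LinearMap.ker F := by
    rw [LinearMap.mem_ker, hF, Fintype.linearCombination_apply]
    simpa [Fin.sum_univ_fun_getElem l f] using hsum
  have hcmem : (fun i : Fin l.length => c l[i.1]) ∈ LinearMap.ker F := by
    rw [LinearMap.mem_ker, hF, Fintype.linearCombination_apply]
    exact (Fin.sum_univ_fun_getElem l fun e => c e • f e).trans hc
  have hne : (⟨_, hone⟩ : LinearMap.ker F) ≠ 0 := fun h => by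
    have := congrFun (congrArg Subtype.val h) ⟨0, hlen⟩
    simp at this
  obtain ⟨r, hr⟩ := (finrank_eq_one_iff_of_nonzero' _ hne).1 hker ⟨_, hcmem⟩
  have hval : ∀ e ∈ l, c e = r := by
    intro e he
    obtain ⟨i, hi, rfl⟩ := List.getElem_of_mem he
    have := congrFun (congrArg Subtype.val hr) ⟨i, hi⟩
    simpa using this.symm
  rw [hval e he, hval e' he']

open Classical in
/-- A unit flow along a walk. -/
theorem exists_flow_of_walk [Fintype V] {x y : V} (p : G.Walk x y) :
    ∃ f : V → V → ℝ, (∀ v w, f v w = -f w v) ∧ (∀ v w, ¬ G.Adj v w → f v w = 0) ∧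
      (∀ v, ∑ w, f v w = (if v = x then 1 else 0) - (if v = y then 1 else 0)) ∧
      ∀ v, v ∉ p.support → ∀ w, f v w = 0 := by
  induction p with
  | nil => exact ⟨0, by simp⟩
  | @cons x y z h p ih =>
    obtain ⟨f, h1, h2, h3, h4⟩ := ih
    refine ⟨fun v w => f v w + ((if v = x ∧ w = y then 1 else 0) -
      (if v = y ∧ w = x then 1 else 0)), fun v w => ?_, fun v w hvw => ?_, fun v => ?_,
      fun v hv w => ?_⟩
    · beta_reduce
      rw [h1 v w]
      simp only [and_comm (a := w = x), and_comm (a := w = y)]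
      ring
    · beta_reduce
      rw [h2 v w hvw, if_neg, if_neg]
      · simp
      · rintro ⟨rfl, rfl⟩
        exact hvw h.symm
      · rintro ⟨rfl, rfl⟩
        exact hvw h
    · rw [Finset.sum_add_distrib, h3, Finset.sum_sub_distrib]
      simp only [ite_and, Finset.sum_ite_irrel, Finset.sum_ite_eq', Finset.mem_univ, if_true,
        Finset.sum_const_zero]
      ring
    · rw [SimpleGraph.Walk.support_cons, List.mem_cons, not_or] at hv
      have hvy : v ≠ y := fun h => hv.2 (h ▸ p.start_mem_support)
      beta_reduce
      rw [h4 v hv.2, if_neg fun h => hv.1 h.1, if_neg fun h => hvy h.1]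
      simp

open Classical in
/-- Two edges at a vertex that is not a cut-vertex lie on a common cycle: there is a circulation
whose values on the arcs leaving the vertex are `1` on the first edge and `-1` on the second. -/
theorem exists_mem_cycleSpace_of_adj [Fintype V] (hG : IsOneBlock G) {v x y : V}
    (hx : G.Adj v x) (hy : G.Adj v y) :
    ∃ f ∈ cycleSpace G, ∀ w, f v w = (if w = x then 1 else 0) - (if w = y then 1 else 0) := by
  obtain ⟨q⟩ := hG.2 v ⟨x, hx.ne'⟩ ⟨y, hy.ne'⟩
  obtain ⟨f, h1, h2, h3, h4⟩ :=
    exists_flow_of_walk (q.map (SimpleGraph.Embedding.induce {w | w ≠ v}).toHom)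
  have hv : v ∉ (q.map (SimpleGraph.Embedding.induce {w | w ≠ v}).toHom).support := by
    rw [SimpleGraph.Walk.support_map, List.mem_map]
    rintro ⟨w, -, hw⟩
    exact w.2 hw
  -- The unit flow from `x` to `y` avoiding `v` is closed up by the arcs from `v` to `x` and from
  -- `y` to `v`.
  refine ⟨fun a b => f a b + (((if a = v ∧ b = x then 1 else 0) - (if a = x ∧ b = v then 1 else 0))
    - ((if a = v ∧ b = y then 1 else 0) - (if a = y ∧ b = v then 1 else 0))),
    ⟨fun a b => ?_, fun a b hab => ?_, fun a => ?_⟩, fun w => ?_⟩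
  · beta_reduce
    rw [h1 a b]
    simp only [and_comm (a := b = x), and_comm (a := b = y), and_comm (a := b = v)]
    ring
  · beta_reduce
    rw [h2 a b hab, if_neg, if_neg, if_neg, if_neg]
    · simp
    all_goals
      rintro ⟨rfl, rfl⟩
      first | exact hab hx | exact hab hx.symm | exact hab hy | exact hab hy.symm
  · rw [Finset.sum_add_distrib, h3, Finset.sum_sub_distrib, Finset.sum_sub_distrib,
      Finset.sum_sub_distrib]
    simp only [ite_and, Finset.sum_ite_irrel, Finset.sum_ite_eq', Finset.mem_univ, if_true,
      Finset.sum_const_zero]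
    change ((if a = x then (1 : ℝ) else 0) - (if a = y then 1 else 0)) + _ = 0
    ring
  · dsimp only
    rw [h4 v hv]
    simp [hx.ne, hy.ne]

/-- In a one-block graph, a symmetric edge labelling that is constant along every cycle of a cycle
basis is constant. -/
theorem IsOneBlock.exists_eq_of_cycleBasis [Fintype V] (hG : IsOneBlock G)
    {B : Finset (Cycle G)} (hB : IsCycleBasis G B) {L : V → V → ℝ} (hL : ∀ v w, L v w = L w v)
    (hLB : ∀ C ∈ B, ∀ e ∈ C.walk.darts, ∀ e' ∈ C.walk.darts, L e.fst e.snd = L e'.fst e'.snd) :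
    ∃ c, ∀ v w, G.Adj v w → L v w = c := by
  classical
  have hstar : ∀ v x y, G.Adj v x → G.Adj v y → L v x = L v y := by
    intro v x y hx hy
    -- The outflow at `v` weighted by `L`. On a basis cycle `L` is constant, so conservation makes
    -- it vanish; it then vanishes on the whole cycle space, in particular on the circulation
    -- through `x` and `y`.
    set φ : (V → V → ℝ) →ₗ[ℝ] ℝ :=
      (Fintype.linearCombination ℝ (L v)).comp (LinearMap.proj v) with hφ
    have hφv : ∀ f, φ f = ∑ w, f v w * L v w := fun f => by
      simp [hφ, Fintype.linearCombination_apply]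
    have hle : cycleSpace G ≤ LinearMap.ker φ := by
      rw [← hB.2, Submodule.span_le]
      rintro - ⟨⟨C, hC⟩, rfl⟩
      have hmem : C.flow ∈ cycleSpace G := by
        rw [← hB.2]
        exact Submodule.subset_span ⟨⟨C, hC⟩, rfl⟩
      obtain ⟨c, hc⟩ : ∃ c, ∀ e ∈ C.walk.darts, L e.fst e.snd = c := by
        by_cases h : ∃ e, e ∈ C.walk.darts
        · obtain ⟨e, he⟩ := h
          exact ⟨_, fun e' he' => hLB C hC e' he' e he⟩
        · exact ⟨0, fun e he => (h ⟨e, he⟩).elim⟩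
      rw [SetLike.mem_coe, LinearMap.mem_ker, hφv]
      have : ∀ w, C.flow v w * L v w = C.flow v w * c := by
        intro w
        by_cases h1 : ∃ e ∈ C.walk.darts, e.fst = v ∧ e.snd = w
        · obtain ⟨e, he, rfl, rfl⟩ := h1
          rw [hc e he]
        by_cases h2 : ∃ e ∈ C.walk.darts, e.fst = w ∧ e.snd = v
        · obtain ⟨e, he, rfl, rfl⟩ := h2
          rw [hL, hc e he]
        · simp [Cycle.flow, h1, h2]
      rw [Finset.sum_congr rfl fun w _ => this w, ← Finset.sum_mul, hmem.2.2 v, zero_mul]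
    obtain ⟨f, hf, hfv⟩ := exists_mem_cycleSpace_of_adj hG hx hy
    have h0 := hle hf
    rw [LinearMap.mem_ker, hφv] at h0
    simp only [hfv, sub_mul, ite_mul, one_mul, zero_mul, Finset.sum_sub_distrib,
      Finset.sum_ite_eq', Finset.mem_univ, if_true] at h0
    linarith
  by_cases h : ∃ v w, G.Adj v w
  · obtain ⟨v₀, w₀, h₀⟩ := h
    refine ⟨L v₀ w₀, fun v => ?_⟩
    obtain ⟨p⟩ := hG.1.preconnected v v₀
    induction p with
    | nil => exact fun w hw => hstar _ _ _ hw h₀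
    | cons hadj p ih =>
      intro w hw
      rw [hstar _ _ _ hw hadj, hL]
      exact ih h₀ _ hadj.symm
  · exact ⟨0, fun v w hvw => (h ⟨v, w, hvw⟩).elim⟩

/-- If the increments of `g` along the edges are multiples, symmetric in the end points, of the
images of the payoff differences under a map whose kernel consists of constants, and the cycles of a
cycle basis have rank one less than their length, then the multiple is the same for all edges. -/
theorem IsOneBlock.exists_eq_of_payoffRank {A Θ M : Type*} [Fintype A] [Fintype Θ]
    [AddCommGroup M] [Module ℝ M] {H : SimpleGraph A} (hH : IsOneBlock H) {u : A → Θ → ℝ}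
    {B : Finset (Cycle H)} (hB : IsCycleBasis H B)
    (hrank : ∀ C ∈ B, C.payoffRank u = C.length - 1)
    {T : (Θ → ℝ) →ₗ[ℝ] M} (hT : ∀ v, T v = 0 → centeredLin v = 0)
    {g : A → M} {L : A → A → ℝ} (hL : ∀ x y, L x y = L y x)
    (hg : ∀ x y, H.Adj x y → g y - g x = L x y • T (u y - u x)) :
    ∃ c : ℝ, ∀ x y, H.Adj x y → L x y = c := by
  refine hH.exists_eq_of_cycleBasis hB hL fun C hC e he e' he' => ?_
  refine eq_of_finrank_eq_length_sub_one (l := C.walk.darts)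
    (f := fun e => payoffDiff u e.fst e.snd) (c := fun e => L e.fst e.snd)
    (List.ne_nil_of_mem he) ?_ ?_ ?_ he he'
  · rw [SimpleGraph.Walk.length_darts]
    exact hrank C hC
  · exact (sum_darts_sub (fun a => centered (u a)) C.walk).trans (sub_self _)
  · have h1 : (C.walk.darts.map fun e => L e.fst e.snd • (u e.snd - u e.fst)).sum ∈
        LinearMap.ker T := by
      rw [LinearMap.mem_ker, map_list_sum, List.map_map, ← sub_self (g C.base),
        ← sum_darts_sub g C.walk]
      congr 1
      exact List.map_congr_left fun e _ => by
        simp only [Function.comp_apply, map_smul]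
        exact (hg _ _ e.adj).symm
    have h2 := hT _ h1
    rw [map_list_sum, List.map_map] at h2
    rw [← h2]
    congr 1
    exact List.map_congr_left fun e _ => by
      simp only [Function.comp_apply, map_smul, map_sub]
      rfl

end Graph

/-! ### Matching the multiples across a product -/

section ProductNecessity

variable {ι : Type*} [Fintype ι] [DecidableEq ι] {A Θ : ι → Type*}

theorem eq_of_update_eq {M : Type*} {F : (∀ i, A i) → M}
    (hF : ∀ a i x, F (Function.update a i x) = F a) (a b : ∀ i, A i) : F a = F b := by
  have h : ∀ s : Finset ι, F (s.piecewise b a) = F a := by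
    intro s
    induction s using Finset.induction_on with
    | empty => simp
    | insert j s _ ih => rw [Finset.piecewise_insert, hF, ih]
  simpa using (h Finset.univ).symm

/-- Any profile is reached from any other by changing one coordinate at a time along a walk in its
graph. -/
theorem eq_of_adj_update_eq {M : Type*} {H : ∀ i, SimpleGraph (A i)}
    (hH : ∀ i, (H i).Connected) {F : (∀ i, A i) → M}
    (hF : ∀ a i x y, (H i).Adj x y → F (Function.update a i y) = F (Function.update a i x))
    (a b : ∀ i, A i) : F a = F b := by
  refine eq_of_update_eq (fun a i x => ?_) a b
  obtain ⟨p⟩ := (hH i).preconnected x (a i)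
  conv_rhs => rw [← Function.update_eq_self i a]
  generalize a i = z at p
  induction p with
  | nil => rfl
  | cons h p ih => rw [← hF a i _ _ h, ih]

/-- Composition with a coordinate projection. -/
def liftLin (Θ : ι → Type*) (i : ι) : (Θ i → ℝ) →ₗ[ℝ] ((∀ i, Θ i) → ℝ) :=
  LinearMap.funLeft ℝ ℝ fun θ => θ i

omit [Fintype ι] [DecidableEq ι] in
theorem liftLin_apply (i : ι) (v : Θ i → ℝ) (θ : ∀ i, Θ i) : liftLin Θ i v θ = v (θ i) := rfl

theorem productPayoff_update_sub (u : ∀ i, A i → Θ i → ℝ) (a : ∀ i, A i) (i : ι) (x y : A i) :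
    productPayoff u (Function.update a i y) - productPayoff u (Function.update a i x) =
      liftLin Θ i (u i y - u i x) := by
  ext θ
  rw [Pi.sub_apply, productPayoff, productPayoff, ← Finset.sum_sub_distrib,
    Finset.sum_eq_single_of_mem i (Finset.mem_univ i)]
  · simp [liftLin_apply]
  · intro j _ hj
    simp [Function.update_of_ne hj]

variable [∀ i, Fintype (Θ i)] [∀ i, Nonempty (Θ i)]

theorem centeredLin_eq_zero_of_liftLin {i : ι} {v : Θ i → ℝ}
    (h : centeredLin (liftLin Θ i v) = 0) : centeredLin v = 0 := by
  rw [centeredLin_eq_zero_iff] at h ⊢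
  intro s t
  obtain ⟨θ⟩ : Nonempty (∀ i, Θ i) := inferInstance
  simpa [liftLin_apply] using h (Function.update θ i s) (Function.update θ i t)

/-- Up to constants, functions of different coordinates agree only if they vanish. -/
theorem centeredLin_liftLin_eq_zero_of_eq {i j : ι} (hij : i ≠ j) {v : Θ i → ℝ} {w : Θ j → ℝ}
    (h : centeredLin (liftLin Θ i v) = centeredLin (liftLin Θ j w)) :
    centeredLin (liftLin Θ i v) = 0 := by
  rw [← sub_eq_zero, ← map_sub, centeredLin_eq_zero_iff] at h
  rw [centeredLin_eq_zero_iff]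
  intro θ θ'
  -- Moving only the coordinate `i` leaves the function of coordinate `j` unchanged.
  have := h θ (Function.update θ i (θ' i))
  simp only [Pi.sub_apply, liftLin_apply, Function.update_self,
    Function.update_of_ne hij.symm] at this ⊢
  linarith

omit [∀ i, Fintype (Θ i)] in
theorem NoWeakDominance.productPayoff_update {u : ∀ i, A i → Θ i → ℝ}
    (hdom : ∀ i, NoWeakDominance (u i)) (a : ∀ i, A i) (i : ι) (x y : A i)
    (h : ∀ θ, productPayoff u (Function.update a i x) θ ≤
      productPayoff u (Function.update a i y) θ) :
    productPayoff u (Function.update a i x) = productPayoff u (Function.update a i y) := by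
  have hxy : u i x = u i y := by
    refine hdom i x y fun t => ?_
    obtain ⟨θ⟩ : Nonempty (∀ i, Θ i) := inferInstance
    have h1 := congrFun (productPayoff_update_sub u a i x y) (Function.update θ i t)
    simp only [Pi.sub_apply, liftLin_apply, Function.update_self] at h1
    have h2 := h (Function.update θ i t)
    linarith
  rw [← sub_eq_zero, productPayoff_update_sub, hxy, sub_self, map_zero]

/-- If the increments of `W` along every edge of every fibre of a product of one-block graphs are
multiples of the payoff differences up to constants, then the multiple depends only on the
component task. -/
theorem exists_coeff_of_edge_multiple [∀ i, Fintype (A i)] {u : ∀ i, A i → Θ i → ℝ}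
    (hblock : ∀ i, IsOneBlock (adjacencyGraph (u i)))
    (hrank : ∀ i, ∃ B : Finset (Cycle (adjacencyGraph (u i))),
      IsMinCycleBasis _ B ∧ ∀ C ∈ B, C.payoffRank (u i) = C.length - 1)
    {Y : (∀ i, A i) → (∀ i, Θ i) → ℝ}
    (hY : ∀ a i x y, (adjacencyGraph (u i)).Adj x y →
      centeredLin (Y (Function.update a i y) - Y (Function.update a i x)) =
        (expect (centeredLin (liftLin Θ i (u i y - u i x)))
            (centeredLin (Y (Function.update a i y) - Y (Function.update a i x))) /
          expect (centeredLin (liftLin Θ i (u i y - u i x)))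
            (centeredLin (liftLin Θ i (u i y - u i x)))) •
          centeredLin (liftLin Θ i (u i y - u i x))) :
    ∃ c : ι → ℝ, ∀ a b, centeredLin (Y a - ∑ i, c i • liftLin Θ i (u i (a i))) =
      centeredLin (Y b - ∑ i, c i • liftLin Θ i (u i (b i))) := by
  have hconn : ∀ i, (adjacencyGraph (u i)).Connected := fun i => (hblock i).1
  obtain ⟨a₀⟩ : Nonempty (∀ i, A i) := Nonempty.intro fun i => (hconn i).nonempty.some
  have hfibre : ∀ a i x y, (adjacencyGraph (u i)).Adj x y →
      centeredLin (Y (Function.update a i y) - Y (Function.update a i x)) =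
        centeredLin (Y (Function.update a₀ i y) - Y (Function.update a₀ i x)) := by
    intro a i x y hxy
    refine eq_of_adj_update_eq hconn (F := fun a =>
      centeredLin (Y (Function.update a i y) - Y (Function.update a i x))) ?_ a a₀
    intro a j s t hst
    by_cases hij : i = j
    · subst hij
      simp only [Function.update_idem]
    have h1 := hY (Function.update a j t) i x y hxy
    have h2 := hY (Function.update a j s) i x y hxy
    have h3 := hY (Function.update a i y) j s t hst
    have h4 := hY (Function.update a i x) j s t hst
    rw [← map_smul, ← map_smul] at h1 h2 h3 h4
    rw [← sub_eq_zero]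
    -- The mixed second difference, taken in either order: one side is a function of coordinate `i`,
    -- the other of coordinate `j`, modulo constants.
    have h5 : centeredLin (Y (Function.update (Function.update a j t) i y) -
          Y (Function.update (Function.update a j t) i x)) -
        centeredLin (Y (Function.update (Function.update a j s) i y) -
          Y (Function.update (Function.update a j s) i x)) =
        centeredLin (Y (Function.update (Function.update a i y) j t) -
          Y (Function.update (Function.update a i y) j s)) -
        centeredLin (Y (Function.update (Function.update a i x) j t) -
          Y (Function.update (Function.update a i x) j s)) := by
      simp only [Function.update_comm (Ne.symm hij), map_sub]
      abel
    have h6 := h5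
    rw [h1, h2, h3, h4, ← map_sub, ← map_sub, ← map_sub, ← map_sub] at h6
    rw [h1, h2, ← map_sub, ← map_sub]
    exact centeredLin_liftLin_eq_zero_of_eq hij h6
  have hcoeff : ∀ i, ∃ c : ℝ, ∀ x y, (adjacencyGraph (u i)).Adj x y →
      centeredLin (Y (Function.update a₀ i y) - Y (Function.update a₀ i x)) =
        c • centeredLin (liftLin Θ i (u i y - u i x)) := by
    intro i
    obtain ⟨B, hB, hBr⟩ := hrank i
    obtain ⟨c, hc⟩ := (hblock i).exists_eq_of_payoffRank hB.1 hBr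
      (T := centeredLin.comp (liftLin Θ i)) (fun v hv => centeredLin_eq_zero_of_liftLin hv)
      (g := fun x => centeredLin (Y (Function.update a₀ i x)))
      -- The explicit quotient is unchanged when `x` and `y` are swapped, since both differences
      -- change sign.
      (L := fun x y => expect (centeredLin (liftLin Θ i (u i y - u i x)))
            (centeredLin (Y (Function.update a₀ i y) - Y (Function.update a₀ i x))) /
          expect (centeredLin (liftLin Θ i (u i y - u i x)))
            (centeredLin (liftLin Θ i (u i y - u i x))))
      (fun x y => by
        rw [← neg_sub (u i x), ← neg_sub (Y (Function.update a₀ i x))]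
        simp only [map_neg, expect_eq_dotProduct, neg_dotProduct, dotProduct_neg, neg_neg])
      (fun x y hxy => by
        rw [← map_sub]
        exact hY a₀ i x y hxy)
    exact ⟨c, fun x y hxy => by rw [hY a₀ i x y hxy, hc x y hxy]⟩
  choose c hc using hcoeff
  refine ⟨c, eq_of_adj_update_eq hconn fun a i x y hxy => ?_⟩
  have h1 := (hfibre a i x y hxy).trans (hc i x y hxy)
  have h2 : ∑ j, c j • liftLin Θ j (u j (Function.update a i y j)) -
      ∑ j, c j • liftLin Θ j (u j (Function.update a i x j)) =
      c i • liftLin Θ i (u i y - u i x) := by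
    rw [← Finset.sum_sub_distrib, Finset.sum_eq_single_of_mem i (Finset.mem_univ i)]
    · simp [smul_sub]
    · intro j _ hj
      simp [Function.update_of_ne hj]
  rw [← sub_eq_zero, ← map_sub, sub_sub_sub_comm, h2, map_sub, h1, map_smul, sub_self]

theorem RobustlyIncentivizable.taskwiseJointlyAligned [∀ i, Fintype (A i)] {m : ℕ}
    {u : ∀ i, A i → Θ i → ℝ} (hdom : ∀ i, NoWeakDominance (u i))
    (hprod : adjacencyGraph (productPayoff u) = cartesianProduct fun i => adjacencyGraph (u i))
    (hblock : ∀ i, IsOneBlock (adjacencyGraph (u i)))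
    (hrank : ∀ i, ∃ B : Finset (Cycle (adjacencyGraph (u i))),
      IsMinCycleBasis _ B ∧ ∀ C ∈ B, C.payoffRank (u i) = C.length - 1)
    {X : (∀ i, A i) → Matrix (Fin m) (∀ i, Θ i) ℝ}
    (h : RobustlyIncentivizable (productPayoff u) X) : TaskwiseJointlyAligned u X := by
  obtain ⟨μ, hμ, hX⟩ := h
  have hdet : ∀ a, IsUnit (μ a).det := fun a => (Matrix.isUnit_iff_isUnit_det _).1 (hμ a)
  have hadj : ∀ a i x y, (adjacencyGraph (u i)).Adj x y →
      (adjacencyGraph (productPayoff u)).Adj (Function.update a i x) (Function.update a i y) := by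
    intro a i x y hxy
    rw [hprod]
    exact ⟨i, by simpa using hxy, fun j hj => by simp [Function.update_of_ne hj]⟩
  have hcoeff : ∀ k, ∃ c : ι → ℝ, ∀ a b,
      centeredLin (((μ a)⁻¹ * X a) k - ∑ i, c i • liftLin Θ i (u i (a i))) =
        centeredLin (((μ b)⁻¹ * X b) k - ∑ i, c i • liftLin Θ i (u i (b i))) := by
    intro k
    refine exists_coeff_of_edge_multiple hblock hrank (Y := fun a => ((μ a)⁻¹ * X a) k) ?_
    intro a i x y hxy
    rw [← productPayoff_update_sub u a i x y]
    exact centeredLin_sub_eq_smul_of_adj hμ hX (hadj a i x y hxy)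
      (NoWeakDominance.productPayoff_update hdom a i x y)
      (NoWeakDominance.productPayoff_update hdom a i y x) k
  choose c hc using hcoeff
  obtain ⟨a₀⟩ : Nonempty (∀ i, A i) := Nonempty.intro fun i => (hblock i).1.nonempty.some
  obtain ⟨θ₀⟩ : Nonempty (∀ i, Θ i) := inferInstance
  -- The remainder after subtracting the payoff combination: its rows depend on the action only
  -- through a constant, which evaluation at `θ₀` recovers.
  set R : (∀ i, A i) → Matrix (Fin m) (∀ i, Θ i) ℝ := fun a => (μ a)⁻¹ * X a -
    ∑ i, Matrix.vecMulVec (fun k => c k i) (fun θ : ∀ i, Θ i => u i (a i) (θ i)) with hR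
  have hRrow : ∀ a k, R a k = ((μ a)⁻¹ * X a) k - ∑ i, c k i • liftLin Θ i (u i (a i)) := by
    intro a k
    ext θ
    simp [hR, Matrix.sum_apply, Matrix.vecMulVec_apply, liftLin_apply, Finset.sum_apply]
  have hRdiff : ∀ a, R a = R a₀ +
      Matrix.vecMulVec (fun k => R a k θ₀ - R a₀ k θ₀) (fun _ => 1) := by
    intro a
    ext k θ
    have h1 := hc k a a₀
    rw [← hRrow, ← hRrow, ← sub_eq_zero, ← map_sub, centeredLin_eq_zero_iff] at h1
    have h2 := h1 θ θ₀
    simp only [Pi.sub_apply] at h2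
    simp only [Matrix.add_apply, Matrix.vecMulVec_apply, mul_one]
    linarith
  refine ⟨R a₀, fun i k => c k i, μ,
    fun a => (μ a).mulVec (fun k => R a k θ₀ - R a₀ k θ₀), hμ, fun a => ?_⟩
  have h1 : (μ a)⁻¹ * X a = R a +
      ∑ i, Matrix.vecMulVec (fun k => c k i) (fun θ : ∀ i, Θ i => u i (a i) (θ i)) := by
    simp only [hR, sub_add_cancel]
  rw [← Matrix.mul_vecMulVec, ← Matrix.mul_add, add_assoc, ← hRdiff, add_comm, ← h1,
    Matrix.mul_nonsing_inv_cancel_left _ _ (hdet a)]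

end ProductNecessity

end BeliefElicitation

theorem mainTheorem2 {ι : Type*} [Fintype ι] [DecidableEq ι] {A Θ : ι → Type*}
    [∀ i, Fintype (A i)] [∀ i, Fintype (Θ i)]
    (hΘ : ∀ i, 2 ≤ Fintype.card (Θ i))
    (u : ∀ i, A i → Θ i → ℝ)
    (hdom : ∀ i, NoWeakDominance (u i))
    (hprod : adjacencyGraph (productPayoff u) = cartesianProduct fun i => adjacencyGraph (u i))
    (hblock : ∀ i, IsOneBlock (adjacencyGraph (u i)))
    (m : ℕ)
    (hlen : CycleLengthCondition (adjacencyGraph (productPayoff u))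
      (Fintype.card (∀ i, Θ i)) m)
    (hrank : RankConditions u)
    (X : (∀ i, A i) → Matrix (Fin m) (∀ i, Θ i) ℝ) :
    RobustlyIncentivizable (productPayoff u) X ↔ TaskwiseJointlyAligned u X := by
  have hA : ∀ i, Nonempty (A i) := fun i => (hblock i).1.nonempty
  have hΘ' : ∀ i, Nonempty (Θ i) := fun i =>
    Fintype.card_pos_iff.1 (zero_lt_two.trans_le (hΘ i))
  exact ⟨fun h => h.taskwiseJointlyAligned hdom hprod hblock hrank.2,
    fun h => h.robustlyIncentivizable⟩
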